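/- For a simple graph $G$ and an integer $k\ge 1$, a packing $k$-coloring of $G$ is a map $f:V(G)\to\{1,2,\ldots,k\}$ such that, for every $i$, any two distinct vertices of color $i$ are at distance at least $i+1$ in $G$. The packing chromatic number $\chi_\rho(G)$ is the smallest integer $k$ for which $G$ has a packing $k$-coloring (and $\chi_\rho(G)=\infty$ if there is none). For a positive integer $t$, let $D(1,t)=G(\mathbb{Z},\{1,t\})$ be the graph with vertex set $\mathbb{Z}$ in which two distinct integers $i,j$ are adjacent if and only if $|i-j|\in\{1,t\}$. Then for every odd integer $t\ge 447$, $$\chi_\rho(D(1,t))\le 40.$$ -/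

import Mathlib

/-- The distance graph `G(ℤ, D)`: the vertices are the integers, and two distinct integers are
adjacent if and only if the absolute value of their difference lies in `D`. -/
def distanceGraph (D : Set ℕ) : SimpleGraph ℤ where
  Adj i j := i ≠ j ∧ (i - j).natAbs ∈ D
  symm := ⟨fun i j h => ⟨h.1.symm, by rw [← Int.natAbs_neg, neg_sub]; exact h.2⟩⟩
  loopless := ⟨fun _ h => h.1 rfl⟩

/-- `f` is a packing `k`-coloring of `G`: the colors are taken from `{1, …, k}`, and any two
distinct vertices of the same color `i` are at distance at least `i + 1` in `G`. The distance
is `ℕ∞`-valued, infinite between vertices of different components. -/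
def IsPackingColoring {V : Type*} (G : SimpleGraph V) (k : ℕ) (f : V → ℕ) : Prop :=
  (∀ v, f v ∈ Set.Icc 1 k) ∧
    ∀ i : ℕ, ∀ u v : V, u ≠ v → f u = i → f v = i → ((i + 1 : ℕ) : ℕ∞) ≤ G.edist u v

/-- The packing chromatic number: the least `k` for which `G` has a packing `k`-coloring, and `⊤`
if there is no such `k`. -/
noncomputable def packingChromaticNumber {V : Type*} (G : SimpleGraph V) : ℕ∞ :=
  ⨅ (k : ℕ) (_ : ∃ f : V → ℕ, IsPackingColoring G k f), (k : ℕ∞)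

/-!
Every pair of vertices of `D(1, t)` at distance at most `d` differs by `a + b t` with
`|a| + |b| ≤ d`. Writing `n = i + j t` with `0 ≤ i < t` therefore presents `D(1, t)` as the square
lattice `ℤ²` rolled up along the vector `(t, -1)`, and a packing coloring of `D(1, t)` with colors
at most `t` amounts to a coloring of the lattice which is invariant under `(t, -1)` and in which
distinct cells of the same color `c` lie at `ℓ¹`-distance more than `c`.

The square lattice has a packing coloring `p` with 17 colors and period 24 in both directions
(`pattern`), whose color 1 fills the cells with `i + j` odd. It is not invariant under `(t, -1)`.
For each odd residue `r` modulo 24, however, there is a vertical band of 24 columns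
(`transition r`), colored with `1, …, 23` and with vertical period 24, that fits between the copy
`p (i, j)` on its left and the displaced copy `p (i - r, j + 1)` on its right. Let `r = t mod 24`,
place the band at the columns `24, …, 47`, the pattern to its left and the displaced pattern to its
right (`strip`). Since `t ≥ 48`, the column `t + i` shows, for `0 ≤ i < 24`, the color
`p (t + i - r, j + 1) = p (i, j + 1)` in row `j`, which is the color of the cell `(i, j + 1)`. So
the columns `0, …, t - 1` can be rolled up along `(t, -1)` (`strip_add_eq`): no distance above 23
matters, so any two cells to be compared appear as cells of the strip, the left one of them in a
column below `t` (`spiral_add`).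

That the band fits on both sides is a finite computation (`packedBelow_pattern`,
`packedBelow_strip`); `packedAt_strip` extends it to all columns. The resulting coloring of
`D(1, t)` uses only the colors `1, …, 23`.
-/

/-! ### The tables -/

/-- The packing 17-coloring of the square lattice with period 24 in both directions. The `j`-th
entry lists, as two decimal digits each from left to right, the colors of the cells `(i, j)` with
`0 ≤ i < 24` and `i + j` even; all other cells have color 1. -/
def pattern : List ℕ :=
  [020302050604020302110715, 050803020307050603020304, 030212041102030210040509,
   070302030514090302030602, 130405100203020405080203, 030203070406030203170405,
   110609020302050712020302, 020304050803020306050703, 040502030213041102030210,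
   030715060302030509040302, 080203020405100203021405, 160405030203060407030203,
   020302110709020302050604, 050603020304050803020307, 030210040502030215041102,
   040302030612070302030509, 021305140203020405100203, 030203080405030203070406,
   050704020302110609020302, 020306050703020304051203, 041102030210040502030208,
   030509040302030713060302, 100203021705080203020405, 060407030203160405030203]

/-- For odd `r < 24`, the band of columns `0 ≤ i < 24`, in the format of `pattern`, that leads from
the coloring `p` given by `pattern` at `i < 0` to `p (i - r, j + 1)` at `i ≥ 24`. Other
values of `r` are not used and have the empty table. -/
def transition : ℕ → List ℕ
  | 1 =>
    [020302050604090517030203, 051903020307150210040509, 030208041102030403020306,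
     070302030514021605080203, 130405100203060302032004, 030203070402050712020302,
     110609020322030203060507, 020304050213041102030210, 040502030608020305090403,
     030715020305100203211405, 080203180402030604020302, 230405030709020307050604,
     020302111703040502030203, 050603020519030815041102, 030210040302120203020305,
     040302160603070405100203, 021305140204020306030704, 030203082005110209020302,
     050704020302031303040512, 020306050710020502030208, 041102030203040307230603,
     030509042102060203020405, 100203020305081804050302, 060407120203020302110719]
  | 3 =>
    [020302130406020317060302, 050703020311050402100405, 030204080502030209030203,
     220302030704150312081902, 191105100203020605020318, 030203040905030207040203,
     200618020302080423030605, 020307051416020311020302, 040502030204031002130904,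
     030912060302070504030220, 080203021105210306020703, 130415030203040203051406,
     020302050417020922080302, 050603020306050302150411, 030210070802031207030203,
     040302030513190204061002, 021605040203041803020307, 030203060907021105090203,
     050714020302050302030405, 020311050403060416020302, 042302030210200203071306,
     030504070302030502030204, 100203021205040814040503, 210609030203070203021107]
  | 5 =>
    [020302050603020308051103, 050803021104070203021004, 030222040302030509060302,
     070302230514020302040519, 190405100203060413030203, 030203070402030205070802,
     110613020308051603020306, 020304050203021004150203, 040502031209070302030512,
     030715060302040511020302, 080203020405170203090407, 180405030203060802030205,
     020302110721020304051803, 050603020304050203021004, 030210040502031907220302,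
     040302030613020302040523, 022005140203090405030203, 030203160405030206080902,
     050704020302071103020304, 020306050803021504050203, 041102030210040302031413,
     030517040302060507020302, 100203020718030203200405, 060409030205120402030221]
  | 7 =>
    [020302070511031802030506, 050803020304020320140221, 030212040902070805040903,
     070302030605030203020705, 130405220203190415060302, 030203140410020302051204,
     161106020302030507030203, 020304050717090204081102, 040502030208040603020305,
     030709230305021605130203, 080203020402120302030604, 180420030603070410020302,
     020302100511020503090518, 050603020304211402030208, 030213040702030206040703,
     040302030905080305021505, 021708050203020402220306, 030203150406030703170219,
     190511020302100511020509, 020304160503020304080302, 040702030207040902060207,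
     030905060802031205032303, 210203020403050203020402, 060410030213060407100316]
  | 9 =>
    [020302100604080302030705, 050803020302050413020302, 030212040507030203050904,
     070302030211061502030221, 230405130903021607040603, 030203020405030203020507,
     190622070302100405080302, 020304050803020302110419, 040502030214070906030203,
     030911060302030204051802, 180203020412200503020306, 080405030203021707100203,
     020302100705060302030405, 050603020302130405020302, 030216040915030203091207,
     040302030211070802030204, 021305080603022306040503, 030203020405030203021606,
     050704210302190414070302, 020302050703020302220405, 041409030218060510030203,
     030511040302030211050802, 200203021705090703020320, 060407030203021206040203]
  | 11 =>
    [020302050309050803020307, 051003060207020604110203, 030222041603040302030519,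
     070302030502120510020302, 210405130211030203070406, 030203070406170402030205,
     110609020302050309050803, 020304051003070206022304, 040502030208041503040302,
     030712060302030502130510, 180203020405140211160703, 080405030203060403020402,
     020302110907020308050318, 050603020304051002060203, 030210040502030207030917,
     160302030621190322020302, 020407150203020402120405, 031305170805030605030211,
     052002032302070203020703, 020306020304111304081004, 041109040510030502150302,
     030502030206020309060514, 190203071403180407030203, 060408020402030205200402]
  | 13 =>
    [020302070604020508030203, 050803020316070206041102, 030212040502030403020305,
     070302032111020905100203, 130405100203050302030704, 030203140702171204020302,
     190609020304060203150513, 020304050203080502060208, 041102032013020307030403,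
     030507060309040211020905, 080203020405031003050302, 230415030207180602161922,
     020302050803020304030203, 050603021104050208070502, 030216040302031409020306,
     040302070506020305210203, 021305100203120402031004, 030203170402030706020302,
     050704020309051503040507, 020306051903021102030217, 041802030208040305200903,
     030911040302060203020605, 100203022205101304070302, 060405030203230302051804]
  | 15 =>
    [020302051602030713050302, 051003020304020302080411, 030819041209110504030203,
     070213030502030210090719, 210403020703081703020302, 021105060215020605042103,
     180302031404050302030205, 060904020302070422180302, 040203080510030203020604,
     030502030206090508030207, 161207230403020312041603, 200203021105040203021120,
     020304050302031306050302, 050602090708020302070405, 030217030203190504030203,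
     040310040502030210090802, 021308020321060703020317, 030203150203021105040203,
     050704061804050302030605, 020311020302090814020302, 041402030507030203072304,
     030509040210040502030209, 220203020803020306041503, 060407030605200203021206]
  | 17 =>
    [020302050604020304050803, 050803020307050903021204, 030212041102030220070302,
     070302030514060302040510, 130405100203020405030203, 030203070408030211060902,
     110619020302050703020304, 020304050603021004050203, 040502030222040302030715,
     030715090302170508020302, 080203020413030203160405, 160405030205060402030211,
     020302180712020307050603, 050603020304110203021004, 030220040502030509040302,
     040302030610020302130514, 021305140203070406030203, 030203080423030205070402,
     050704020302051903020306, 020306052103020804110203, 041102030216060302030509,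
     030517040302040510020302, 100203020905130203060407, 060407030203151802030205]
  | 19 =>
    [020302050604170302090508, 050803020302070504030212, 030214041005030206020703,
     070302030209082303130405, 130406200703020302050302, 030203020406050414110609,
     161809050302030207030203, 020302081119120321040502, 060507040203041009020307,
     030203060507020605080203, 080422020302130302031704, 021205150403050416020302,
     230302030209080203070506, 050604070302031102030210, 030203021405041805040903,
     041708030203070203021305, 021305110406020320060302, 030203020310050402050704,
     050704160502030212030203, 020306030704090308041102, 041002210203020607021905,
     030509040805030205030203, 190203020302110403100604, 060407121303021522020302]
  | 21 =>
    [020302050604020302100405, 050803020317110403020302, 030216041002030206051307,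
     070302030509070302030204, 130405140203021808041603, 030203070406030203021106,
     110609020302150405070302, 020304050803020302140405, 040502030219051009030220,
     030712060302030604050302, 230203021104070203020822, 080405030203130512030203,
     020302102105020302170705, 050603020309080403020302, 030218040702030211050904,
     040302030604050302030213, 021705080203021607040603, 030203150514030203020507,
     050704020302100405080302, 020306090403020302190411, 041002030207050609030203,
     030511220302032304051502, 190203021320080203022106, 060407030203120507030203]
  | 23 =>
    [202104120304050703020320, 020302050203020604090203, 220508031109170302030518,
     030206020302040508020302, 130703100405030203070413, 020402030206151202030211,
     180309050703020304051003, 060203020804050203021404, 040516040302030709060302,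
     031102060513020302040508, 190207030203100411030203, 080405230402030205190702,
     020312020307050603020312, 050603090220020804170203, 030210040503040302030509,
     040302030602140507020302, 021305070211030203100406, 030203150405120402030205,
     051704081802090322050803, 020306020307060203022104, 071102030510030513040302,
     041409040216020302070515, 100305021903080411030203, 060203070602030205230402]
  | _ => []

/-- The color of the cell `(x, j)` in the coloring with period 24 in both directions that is given
by the table `T`. -/
def cell (T : List ℕ) (x j : ℕ) : ℕ :=
  if (x + j) % 2 = 1 then 1 else T.getD (j % 24) 0 / 100 ^ (11 - x % 24 / 2) % 100

/-- The transition band together with what surrounds it: 24 columns of the pattern, the band at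
the columns `24 ≤ x < 48`, and the pattern displaced by `(r, -1)` from there on. Columns here are
numbered by `x = i + 24` in terms of the docstring of `transition`; since the pattern has period 24,
this does not affect the displacement. -/
def strip (r x j : ℕ) : ℕ :=
  if x < 24 then cell pattern x j
  else if x < 48 then cell (transition r) x j
  else cell pattern (x - r) (j + 1)

/-! ### The finite verification -/

/-- Bounded quantification over `k < n` as a Boolean, by direct recursion, for evaluation by the
kernel. -/
def allBelow (n : ℕ) (p : ℕ → Bool) : Bool :=
  Nat.rec true (fun k ih => cond (p k) ih false) n

theorem allBelow_eq_true {n : ℕ} {p : ℕ → Bool} :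
    allBelow n p = true ↔ ∀ k < n, p k = true := by
  induction n with
  | zero => simp [allBelow]
  | succ n ih =>
    have h : allBelow (n + 1) p = cond (p n) (allBelow n p) false := rfl
    rw [h, Nat.forall_lt_succ_right]
    cases hp : p n <;> simp [ih]

/-- In the coloring `W`, of period 24 in the second coordinate, no cell in the columns from `m` on
that lies within `ℓ¹`-distance `c` of `(x, j)` and not to the left of it has color `c`, apart from
`(x, j)` itself. The periodicity expresses a vertical step `-b` as `24 - b`, for `b ≤ 24`. -/
def avoidsRight (W : ℕ → ℕ → ℕ) (m c x j : ℕ) : Bool :=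
  allBelow (c + 1) fun a => cond (Nat.blt (x + a) m) true <|
    allBelow (c + 1 - a) fun b => cond (Nat.beq (a + b) 0) true <|
      cond (Nat.beq (W (x + a) (j + b)) c) false
        (cond (Nat.beq (W (x + a) (j + (24 - b))) c) false true)

/-- In the coloring `W`, of period 24 in the second coordinate, the cells of the first `n` columns
have colors from 1 to 23 and satisfy the packing condition towards all cells in the columns from
`m` on that are not further to the left. -/
def packedBelow (W : ℕ → ℕ → ℕ) (m n : ℕ) : Bool :=
  allBelow n fun x => allBelow 24 fun j =>
    cond (Nat.ble 1 (W x j)) (cond (Nat.ble (W x j) 23) (avoidsRight W m (W x j) x j) false) false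

theorem ne_of_packedBelow {W : ℕ → ℕ → ℕ} {m n x j : ℕ} (h : packedBelow W m n = true)
    (hx : x < n) (hj : j < 24) :
    (1 ≤ W x j ∧ W x j ≤ 23) ∧ ∀ a b : ℕ, a + b ≠ 0 → a + b ≤ W x j → m ≤ x + a →
      W (x + a) (j + b) ≠ W x j ∧ W (x + a) (j + (24 - b)) ≠ W x j := by
  have h1 := allBelow_eq_true.1 (allBelow_eq_true.1 h x hx) j hj
  simp only [Bool.cond_false_right, Bool.and_eq_true, Nat.ble_eq] at h1
  refine ⟨⟨h1.1, h1.2.1⟩, fun a b hab hle hm => ?_⟩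
  have h2 := allBelow_eq_true.1 h1.2.2 a (by omega)
  have hlt : Nat.blt (x + a) m = false := by
    rw [Bool.eq_false_iff, ne_eq, Nat.blt_eq]; omega
  rw [hlt, cond_false] at h2
  have h3 := allBelow_eq_true.1 h2 b (by omega)
  have hz : Nat.beq (a + b) 0 = false := by
    rw [Bool.eq_false_iff, ne_eq, Nat.beq_eq]; exact hab
  rw [hz, cond_false] at h3
  constructor
  · intro he
    rw [he, Nat.beq_refl] at h3
    simp at h3
  · intro he
    rw [he, Nat.beq_refl] at h3
    simp at h3

theorem packedBelow_pattern : packedBelow (cell pattern) 0 24 = true := by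
  decide +kernel

/-- Pairs of cells in the first 24 columns are left out, as they are covered by
`packedBelow_pattern`. -/
theorem packedBelow_strip : ∀ k < 12, packedBelow (strip (2 * k + 1)) 24 48 = true := by
  decide +kernel

/-! ### All rows and columns -/

theorem cell_congr (T : List ℕ) {x x' j j' : ℕ} (hx : x % 24 = x' % 24) (hj : j % 24 = j' % 24) :
    cell T x j = cell T x' j' := by
  have hp : (x + j) % 2 = (x' + j') % 2 := by omega
  rw [cell, cell, hp, hx, hj]

theorem strip_congr (r x : ℕ) {j j' : ℕ} (hj : j % 24 = j' % 24) :
    strip r x j = strip r x j' := by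
  have hj1 : (j + 1) % 24 = (j' + 1) % 24 := by omega
  rw [strip, strip, cell_congr pattern rfl hj, cell_congr (transition r) rfl hj,
    cell_congr pattern rfl hj1]

/-- The cell `(x, j)` has a color `c` with `1 ≤ c ≤ 23` in `W`, and no other cell within
`ℓ¹`-distance `c` that is not further to the left has color `c`. Vertical steps are to be read
modulo 24. -/
def PackedAt (W : ℕ → ℕ → ℕ) (x j : ℕ) : Prop :=
  (1 ≤ W x j ∧ W x j ≤ 23) ∧ ∀ a b : ℕ, a + b ≠ 0 → a + b ≤ W x j →
    W (x + a) (j + b) ≠ W x j ∧ W (x + a) (j + (24 - b)) ≠ W x j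

theorem packedAt_pattern (x j : ℕ) : PackedAt (cell pattern) x j := by
  have h := ne_of_packedBelow packedBelow_pattern
    (Nat.mod_lt x (by norm_num : 24 > 0)) (Nat.mod_lt j (by norm_num : 24 > 0))
  rw [cell_congr pattern (Nat.mod_mod x 24) (Nat.mod_mod j 24)] at h
  refine ⟨h.1, fun a b hab hle => ?_⟩
  have h2 := h.2 a b hab hle (Nat.zero_le _)
  rwa [cell_congr pattern (Nat.mod_add_mod x 24 a) (Nat.mod_add_mod j 24 b),
    cell_congr pattern (Nat.mod_add_mod x 24 a) (Nat.mod_add_mod j 24 (24 - b))] at h2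

theorem packedAt_strip {r : ℕ} (hr : Odd r) (hr24 : r < 24) (x j : ℕ) :
    PackedAt (strip r) x j := by
  rcases lt_or_ge x 48 with hx | hx
  · obtain ⟨k, rfl⟩ := hr
    have h := ne_of_packedBelow (packedBelow_strip k (by omega)) hx
      (Nat.mod_lt j (by norm_num : 24 > 0))
    rw [strip_congr _ x (Nat.mod_mod j 24)] at h
    refine ⟨h.1, fun a b hab hle => ?_⟩
    rcases lt_or_ge (x + a) 24 with hxa | hxa
    · -- Both cells lie in the copy of the pattern on the left.
      have hs : ∀ i, strip (2 * k + 1) x i = cell pattern x i := fun i =>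
        if_pos (by omega)
      have hsa : ∀ i, strip (2 * k + 1) (x + a) i = cell pattern (x + a) i := fun i => if_pos hxa
      rw [hs] at hle ⊢
      rw [hsa, hsa]
      exact (packedAt_pattern x j).2 a b hab hle
    · have h2 := h.2 a b hab hle hxa
      rwa [strip_congr _ (x + a) (Nat.mod_add_mod j 24 b),
        strip_congr _ (x + a) (Nat.mod_add_mod j 24 (24 - b))] at h2
  · have hs : ∀ y i, 48 ≤ y → strip r y i = cell pattern (y - r) (i + 1) := fun y i hy => by
      rw [strip, if_neg (by omega), if_neg (by omega)]
    have h := packedAt_pattern (x - r) (j + 1)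
    rw [PackedAt, hs x j hx]
    refine ⟨h.1, fun a b hab hle => ?_⟩
    rw [hs _ _ (by omega), hs _ _ (by omega), Nat.sub_add_comm (by omega : r ≤ x),
      Nat.add_right_comm j b 1, Nat.add_right_comm j (24 - b) 1]
    exact h.2 a b hab hle

/-- The representative of the row `j` in the range `0, …, 23`. -/
def row (j : ℤ) : ℕ := (j % 24).toNat

/-- The packing condition in the strip, towards the right, for arbitrary integral rows. -/
theorem strip_ne_of_natAbs_add_natAbs_le {r : ℕ} (hr : Odd r) (hr24 : r < 24) (x a : ℕ) (j b : ℤ)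
    (hab : a + b.natAbs ≠ 0) (hle : a + b.natAbs ≤ strip r x (row j)) :
    strip r (x + a) (row (j + b)) ≠ strip r x (row j) := by
  obtain ⟨⟨-, h23⟩, h⟩ := packedAt_strip hr hr24 x (row j)
  have h := h a b.natAbs hab hle
  rcases le_total 0 b with hb | hb
  · rw [strip_congr r (x + a) (j' := row j + b.natAbs) (by unfold row; omega)]
    exact h.1
  · rw [strip_congr r (x + a) (j' := row j + (24 - b.natAbs)) (by unfold row; omega)]
    exact h.2

/-! ### Rolling up the strip -/

/-- The coloring of `D(1, t)`: the integer `x + j t` with `0 ≤ x < t` is the cell `(x, j)` of the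
strip. -/
def spiral (t : ℕ) (n : ℤ) : ℕ := strip (t % 24) (n % t).toNat (row (n / t))

/-- The coloring of the strip closes up under `(t, -1)` where this is needed: at the 24 columns
from `t` on. -/
theorem strip_add_eq {t x : ℕ} (ht : 48 ≤ t) (hx : x < 24) (j : ℤ) :
    strip (t % 24) (x + t) (row j) = strip (t % 24) x (row (j + 1)) := by
  rw [strip, if_neg (by omega), if_neg (by omega), strip, if_pos hx]
  exact cell_congr pattern (by omega) (by unfold row; omega)

/-- Steps by fewer than 24 columns to the right in the strip compute the coloring of `D(1, t)`, even
where they leave the fundamental domain of width `t`. -/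
theorem spiral_add {t a : ℕ} (ht : 48 ≤ t) (ha : a < 24) (n b : ℤ) :
    spiral t (n + a + t * b) = strip (t % 24) ((n % t).toNat + a) (row (n / t + b)) := by
  have ht0 : (0 : ℤ) < t := by omega
  have hn := Int.emod_add_mul_ediv n t
  have h0 := Int.emod_nonneg n ht0.ne'
  have h1 := Int.emod_lt_of_pos n ht0
  generalize n % (t : ℤ) = x at *
  generalize n / (t : ℤ) = j at *
  subst hn
  lift x to ℕ using h0
  rcases lt_or_ge (x + a) t with h | h
  · obtain ⟨hd, hm⟩ := (Int.ediv_emod_unique (a := x + t * j + a + t * b) (r := (x + a : ℕ))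
      (q := j + b) ht0).2 ⟨by push_cast; ring, by omega, by omega⟩
    rw [spiral, hd, hm, Int.toNat_natCast, Int.toNat_natCast]
  · obtain ⟨hd, hm⟩ := (Int.ediv_emod_unique (a := x + t * j + a + t * b) (r := (x + a - t : ℕ))
      (q := j + b + 1) ht0).2 ⟨by push_cast [h]; ring, by omega, by omega⟩
    rw [spiral, hd, hm, Int.toNat_natCast, Int.toNat_natCast,
      ← strip_add_eq ht (by omega) (j + b), Nat.sub_add_cancel h]

theorem spiral_mem_Icc {t : ℕ} (ht : Odd t) (n : ℤ) : spiral t n ∈ Set.Icc 1 23 :=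
  (packedAt_strip (by rw [Nat.odd_iff] at *; omega) (Nat.mod_lt t (by norm_num)) _ _).1

/-- The packing condition for `spiral`, towards the right. -/
theorem spiral_add_ne {t : ℕ} (ht_odd : Odd t) (ht : 48 ≤ t) (n : ℤ) (a : ℕ) (b : ℤ)
    (hab : a + b.natAbs ≠ 0) (hle : a + b.natAbs ≤ spiral t n) :
    spiral t (n + a + t * b) ≠ spiral t n := by
  have h23 := (spiral_mem_Icc ht_odd n).2
  rw [spiral_add ht (by omega)]
  exact strip_ne_of_natAbs_add_natAbs_le (by rw [Nat.odd_iff] at *; omega)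
    (Nat.mod_lt t (by norm_num)) _ a _ b hab hle

theorem exists_eq_add_of_walk {t : ℕ} {u v : ℤ} (p : (distanceGraph {1, t}).Walk u v) :
    ∃ a b : ℤ, v = u + a + t * b ∧ a.natAbs + b.natAbs ≤ p.length := by
  induction p with
  | nil => exact ⟨0, 0, by ring, by simp⟩
  | @cons u w v h p ih =>
    obtain ⟨a, b, rfl, hle⟩ := ih
    rw [SimpleGraph.Walk.length_cons]
    rcases h.2 with h | h
    · exact ⟨a + (w - u), b, by ring, by omega⟩
    · rcases Int.natAbs_eq_iff.1 h with h | h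
      · exact ⟨a, b - 1, by linear_combination -h, by omega⟩
      · exact ⟨a, b + 1, by linear_combination -h, by omega⟩

theorem isPackingColoring_spiral {t : ℕ} (ht_odd : Odd t) (ht : 48 ≤ t) :
    IsPackingColoring (distanceGraph {1, t}) 23 (spiral t) := by
  refine ⟨spiral_mem_Icc ht_odd, fun c u v huv hu hv => ?_⟩
  by_contra! hlt
  obtain ⟨p, hp⟩ := SimpleGraph.exists_walk_of_edist_ne_top (ne_top_of_lt hlt)
  rw [← hp, Nat.cast_lt, Nat.lt_succ_iff] at hlt
  obtain ⟨a, b, hab, hle⟩ := exists_eq_add_of_walk p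
  have h0 : a.natAbs + b.natAbs ≠ 0 := by
    intro h
    obtain ⟨rfl, rfl⟩ : a = 0 ∧ b = 0 := by omega
    exact huv (by rw [hab]; ring)
  -- By symmetry the step from one vertex to the other may be taken to go to the right.
  rcases le_total 0 a with ha | ha
  · refine spiral_add_ne ht_odd ht u a.natAbs b h0 (by omega) ?_
    rw [Int.natAbs_of_nonneg ha, ← hab, hu, hv]
  · refine spiral_add_ne ht_odd ht v a.natAbs (-b) (by omega) (by omega) ?_
    rw [Int.ofNat_natAbs_of_nonpos ha, hab, show u + a + t * b + -a + t * -b = u by ring, ← hab,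
      hu, hv]

theorem mainTheorem1 (t : ℕ) (ht_odd : Odd t) (ht : 447 ≤ t) :
    packingChromaticNumber (distanceGraph {1, t}) ≤ 40 := by
  have h : packingChromaticNumber (distanceGraph {1, t}) ≤ (23 : ℕ) :=
    iInf₂_le 23 ⟨spiral t, isPackingColoring_spiral ht_odd (by omega)⟩
  exact h.trans (by norm_num)
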